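/- Let $I$ be a set with $n\ge 2$ elements ($n$ finite or infinite), let $\mathbb{F}_n^+$ be the free semigroup on the letters in $I$, including the empty word, and let $\{\xi_w : w\in\mathbb{F}_n^+\}$ be the canonical orthonormal basis of the complex Hilbert space $\mathcal{F}_n=\ell^2(\mathbb{F}_n^+)$. For $i\in I$ let $L_i$ and $R_i$ be the isometries of $\mathcal{F}_n$ with $L_i\xi_w=\xi_{iw}$ and $R_i\xi_w=\xi_{wi}$ for all $w\in\mathbb{F}_n^+$. Let $\mathcal{L}_n\subseteq\mathcal{B}(\mathcal{F}_n)$ be the smallest unital subalgebra that contains every $L_i$ and is closed in the weak operator topology. Call $T\in\mathcal{B}(\mathcal{F}_n)$ an $R$-Toeplitz operator if $R_i^*TR_i=T$ for all $i\in I$ and $R_i^*TR_j=0$ for all $i\neq j$ in $I$, and let $\mathcal{T}_R$ be the set of all $R$-Toeplitz operators. Then \[ \mathcal{T}_R=\{B^*C : B,C\in\mathcal{L}_n\}. \] Moreover, every $T\in\mathcal{T}_R$ can be written as $T=B^*C$ with $B,C\in\mathcal{L}_n$ both bounded below, i.e. such that there is a constant $c>0$ with $\|Bx\|\ge c\|x\|$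 and $\|Cx\|\ge c\|x\|$ for all $x\in\mathcal{F}_n$. -/

import Mathlib

namespace FreeSemigroupAlg

noncomputable section

/-- The Fock space `ℓ²(𝔽⁺)`, where `𝔽⁺` is the free semigroup (with the empty word) on the set of
letters `ι`, i.e. Mathlib's free monoid on `ι`. -/
abbrev Fock (ι : Type*) : Type _ := lp (fun _ : FreeMonoid ι => ℂ) 2

open Classical in
/-- The canonical basis vector `ξ_w` of Fock space. -/
def xi {ι : Type*} (w : FreeMonoid ι) : Fock ι := lp.single 2 w (1 : ℂ)

theorem orthonormal_xi {ι : Type*} :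
    Orthonormal ℂ (xi : FreeMonoid ι → Fock ι) := by
  classical
  rw [orthonormal_iff_ite]
  intro v w
  rw [xi, lp.inner_single_left, xi, lp.single_apply]
  by_cases h : v = w
  · subst h; simp
  · simp [h]

/-- The isometry of Fock space which sends `ξ_w` to `ξ_{f w}`, for an injective map `f` of words. -/
def shift {ι : Type*} (f : FreeMonoid ι → FreeMonoid ι) (hf : Function.Injective f) :
    Fock ι →ₗᵢ[ℂ] Fock ι :=
  ((orthonormal_xi (ι := ι)).comp f hf).orthogonalFamily.linearIsometry

theorem shift_xi {ι : Type*} (f : FreeMonoid ι → FreeMonoid ι) (hf : Function.Injective f)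
    (w : FreeMonoid ι) : shift f hf (xi w) = xi (f w) := by
  classical
  simp [shift, xi]

/-- The isometry `L_v`, with `L_v ξ_w = ξ_{vw}`. -/
def opL {ι : Type*} (v : FreeMonoid ι) : Fock ι →L[ℂ] Fock ι :=
  (shift (fun w => v * w) (mul_right_injective v)).toContinuousLinearMap

/-- The isometry `R_v`, with `R_v ξ_w = ξ_{wv}`. -/
def opR {ι : Type*} (v : FreeMonoid ι) : Fock ι →L[ℂ] Fock ι :=
  (shift (fun w => w * v) (mul_left_injective v)).toContinuousLinearMap

theorem opL_xi {ι : Type*} (v w : FreeMonoid ι) : opL v (xi w) = xi (v * w) :=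
  shift_xi _ (mul_right_injective v) w

theorem opR_xi {ι : Type*} (v w : FreeMonoid ι) : opR v (xi w) = xi (w * v) :=
  shift_xi _ (mul_left_injective v) w

/-- A row isometry on a Hilbert space `H`: a family `S` of operators indexed by `ι` with
`S_i^* S_i = I` for all `i` and `S_i^* S_j = 0` for `i ≠ j`. -/
structure RowIsometry (ι H : Type*) [NormedAddCommGroup H] [InnerProductSpace ℂ H]
    [CompleteSpace H] where
  /-- The isometries `S_i`. -/
  op : ι → H →L[ℂ] H
  adjoint_comp_self : ∀ i, ContinuousLinearMap.adjoint (op i) ∘L op i = 1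
  adjoint_comp_of_ne : ∀ i j, i ≠ j → ContinuousLinearMap.adjoint (op i) ∘L op j = 0

section General

variable {ι H : Type*} [NormedAddCommGroup H] [InnerProductSpace ℂ H] [CompleteSpace H]

/-- The set of `S`-Toeplitz operators. -/
def RowIsometry.toeplitz (S : RowIsometry ι H) : Set (H →L[ℂ] H) :=
  {T | (∀ i, ContinuousLinearMap.adjoint (S.op i) ∘L T ∘L S.op i = T) ∧
    ∀ i j, i ≠ j → ContinuousLinearMap.adjoint (S.op i) ∘L T ∘L S.op j = 0}

/-- The free semigroup algebra generated by `S`: the smallest (unital, not necessarily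
self-adjoint) subalgebra of `B(H)` that contains all `S_i` and is closed in the weak operator
topology. -/
def RowIsometry.freeSemigroupAlgebra (S : RowIsometry ι H) : Subalgebra ℂ (H →L[ℂ] H) :=
  sInf {A | (∀ i, S.op i ∈ A) ∧
    IsClosed {T : H →WOT[ℂ] H | T.toCLM ∈ A}}

theorem RowIsometry.op_mem_freeSemigroupAlgebra (S : RowIsometry ι H) (i : ι) :
    S.op i ∈ S.freeSemigroupAlgebra :=
  Algebra.mem_sInf.2 fun _ hA => hA.1 i

theorem RowIsometry.isClosed_freeSemigroupAlgebra (S : RowIsometry ι H) :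
    IsClosed {T : H →WOT[ℂ] H | T.toCLM ∈ S.freeSemigroupAlgebra} := by
  have h : {T : H →WOT[ℂ] H | T.toCLM ∈ S.freeSemigroupAlgebra} =
      ⋂ A ∈ {A : Subalgebra ℂ (H →L[ℂ] H) | (∀ i, S.op i ∈ A) ∧
        IsClosed {T : H →WOT[ℂ] H | T.toCLM ∈ A}}, {T : H →WOT[ℂ] H | T.toCLM ∈ A} := by
    ext T
    simp [RowIsometry.freeSemigroupAlgebra, Algebra.mem_sInf]
  rw [h]
  exact isClosed_biInter fun A hA => hA.2

/-- An operator is bounded below if `c ‖x‖ ≤ ‖T x‖` for some constant `c > 0` and all `x`. -/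
def BoundedBelow (T : H →L[ℂ] H) : Prop :=
  ∃ c : ℝ, 0 < c ∧ ∀ x : H, c * ‖x‖ ≤ ‖T x‖

end General

theorem adjoint_shift_comp_self {ι : Type*} (f : FreeMonoid ι → FreeMonoid ι)
    (hf : Function.Injective f) :
    ContinuousLinearMap.adjoint (shift f hf).toContinuousLinearMap ∘L
      (shift f hf).toContinuousLinearMap = 1 := by
  ext1 x
  refine ext_inner_left ℂ fun y => ?_
  simp

theorem adjoint_shift_comp_of_disjoint {ι : Type*} (f g : FreeMonoid ι → FreeMonoid ι)
    (hf : Function.Injective f) (hg : Function.Injective g) (hfg : ∀ v w, f v ≠ g w) :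
    ContinuousLinearMap.adjoint (shift f hf).toContinuousLinearMap ∘L
      (shift g hg).toContinuousLinearMap = 0 := by
  ext1 x
  refine ext_inner_left ℂ fun y => ?_
  have hx := ((orthonormal_xi (ι := ι)).comp g hg).orthogonalFamily.hasSum_linearIsometry x
  have hy := ((orthonormal_xi (ι := ι)).comp f hf).orthogonalFamily.hasSum_linearIsometry y
  have key : ∀ w, inner ℂ (shift f hf y) (xi (g w)) = 0 := by
    intro w
    have h := hy.mapL (innerSL ℂ (xi (g w)))
    have h0 : inner ℂ (xi (g w)) (shift f hf y) = 0 := by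
      refine h.unique ?_
      convert hasSum_zero using 2 with v
      simp [orthonormal_xi.2 (hfg v w).symm]
    rw [← inner_conj_symm, h0, map_zero]
  have h := hx.mapL (innerSL ℂ (shift f hf y))
  have h0 : inner ℂ (shift f hf y) (shift g hg x) = 0 := by
    refine h.unique ?_
    convert hasSum_zero using 2 with v
    simp [key]
  simpa [ContinuousLinearMap.adjoint_inner_right] using h0

/-- The row isometry `L = [L_1 L_2 ...]`. -/
def rowL (ι : Type*) : RowIsometry ι (Fock ι) where
  op i := opL (FreeMonoid.of i)
  adjoint_comp_self i := adjoint_shift_comp_self _ _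
  adjoint_comp_of_ne i j hij := by
    refine adjoint_shift_comp_of_disjoint _ _ _ _ fun v w h => hij ?_
    exact (List.cons.inj h).1

/-- The row isometry `R = [R_1 R_2 ...]`. -/
def rowR (ι : Type*) : RowIsometry ι (Fock ι) where
  op i := opR (FreeMonoid.of i)
  adjoint_comp_self i := adjoint_shift_comp_self _ _
  adjoint_comp_of_ne i j hij := by
    refine adjoint_shift_comp_of_disjoint _ _ _ _ fun v w h => hij ?_
    exact (List.append_singleton_inj.1 h).2

/-- The non-commutative analytic Toeplitz algebra `𝓛_n`, where `n` is the cardinality of `ι`. -/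
def analyticToeplitz (ι : Type*) : Subalgebra ℂ (Fock ι →L[ℂ] Fock ι) :=
  (rowL ι).freeSemigroupAlgebra

end

end FreeSemigroupAlg

/-!
The free semigroup algebra `𝓛` generated by the left shifts is the commutant of the right shifts
`R_i`. One inclusion is clear, and it shows that `B^* C` is `R`-Toeplitz for `B, C ∈ 𝓛`, because
`R_i^* B^* C R_j = B^* R_i^* R_j C`. For the other inclusion (`mem_analyticToeplitz_of_commute`), an
operator `A` in the commutant is determined by `a = A ξ_∅ = ∑_w a_w ξ_w`, and its Abel means
`∑_w r^{|w|} a_w L_w` are norm-convergent, so they lie in `𝓛`. The matrix entries of the Abel means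
tend to those of `A` as `r → 1`, and the maximum modulus principle bounds their norms by `‖A‖`
(`norm_abelMean_le`), so they converge weakly to `A`.

A positive invertible Toeplitz operator `T` is `B^* B` with `B ∈ 𝓛` invertible
(`exists_adjoint_mul_self_of_isStrictlyPositive`). In the inner product `⟨x, T y⟩` the right shifts
are still isometries with orthogonal ranges. The complement of the sum of these ranges is spanned by
`e = T⁻¹ ξ_∅`, and a Wold argument shows that the vectors `R_w e` form an orthogonal basis. The
operator `B` that sends the normalized `R_w e` to `ξ_w` commutes with the right shifts and satisfies
`B^* B = T`.

An arbitrary Toeplitz operator is a combination `X^* X + i Y^* Y - κ` of such operators and the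
identity. Since there are two letters, `𝓛` contains three isometries `L_a`, `L_{ba}`, `L_{bb}` with
orthogonal ranges, and they turn the sum of three products into the single product
`(L_a X + L_{ba} Y + L_{bb})^* (L_a X + i L_{ba} Y - κ L_{bb})`
(`exists_adjoint_mul_of_mem_toeplitz`). Both factors are bounded below because `X` is.
-/

namespace FreeSemigroupAlg

open Filter Topology ContinuousLinearMap

noncomputable section

/-! ### The canonical basis and the shifts -/

section Basis

variable {ι : Type*}

/-- The canonical basis `ξ_w` of Fock space, bundled as a Hilbert basis. -/
def xiBasis (ι : Type*) : HilbertBasis (FreeMonoid ι) ℂ (Fock ι) :=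
  HilbertBasis.ofRepr (LinearIsometryEquiv.refl ℂ _)

theorem coe_xiBasis : ⇑(xiBasis ι) = xi := by
  classical
  funext w
  rw [← HilbertBasis.repr_symm_single]
  simp only [xiBasis, xi]
  congr!

theorem dense_span_xi :
    Dense (Submodule.span ℂ (Set.range (xi : FreeMonoid ι → Fock ι)) : Set (Fock ι)) := by
  rw [Submodule.dense_iff_topologicalClosure_eq_top, ← coe_xiBasis]
  exact (xiBasis ι).dense_span

theorem inner_xi_left (w : FreeMonoid ι) (x : Fock ι) : inner ℂ (xi w) x = x w := by
  classical
  rw [xi, lp.inner_single_left]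
  simp

theorem inner_xi_xi [DecidableEq (FreeMonoid ι)] (v w : FreeMonoid ι) :
    inner ℂ (xi v : Fock ι) (xi w) = if v = w then 1 else 0 :=
  orthonormal_iff_ite.1 orthonormal_xi v w

theorem ext_xi_inner {x y : Fock ι} (h : ∀ w, inner ℂ (xi w) x = inner ℂ (xi w) y) : x = y := by
  ext w
  simpa [inner_xi_left] using h w

theorem ext_xi {G : Type*} [NormedAddCommGroup G] [NormedSpace ℂ G] {S T : Fock ι →L[ℂ] G}
    (h : ∀ w, S (xi w) = T (xi w)) : S = T :=
  ContinuousLinearMap.ext_on dense_span_xi (by rintro _ ⟨w, rfl⟩; exact h w)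

theorem opL_one : opL (1 : FreeMonoid ι) = 1 := ext_xi fun w => by simp [opL_xi]

theorem opR_one : opR (1 : FreeMonoid ι) = 1 := ext_xi fun w => by simp [opR_xi]

theorem opL_mul (u v : FreeMonoid ι) : opL (u * v) = opL u * opL v :=
  ext_xi fun w => by simp [opL_xi, mul_assoc]

/-- Right multiplication reverses the order of words. -/
theorem opR_mul (u v : FreeMonoid ι) : opR (u * v) = opR v * opR u :=
  ext_xi fun w => by simp [opR_xi, mul_assoc]

theorem opL_mul_opR (u v : FreeMonoid ι) : opL u * opR v = opR v * opL u :=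
  ext_xi fun w => by simp [opL_xi, opR_xi, mul_assoc]

theorem norm_opL_apply (v : FreeMonoid ι) (x : Fock ι) : ‖opL v x‖ = ‖x‖ :=
  (shift (fun w => v * w) (mul_right_injective v)).norm_map x

theorem adjoint_opL_mul_self (v : FreeMonoid ι) : adjoint (opL v) * opL v = 1 :=
  adjoint_shift_comp_self _ _

theorem adjoint_opL_mul_opL {u v : FreeMonoid ι} (h : ∀ x y, u * x ≠ v * y) :
    adjoint (opL u) * opL v = 0 :=
  adjoint_shift_comp_of_disjoint _ _ (mul_right_injective u) (mul_right_injective v) h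

theorem adjoint_opR_of_mul_opR_of [DecidableEq ι] (i j : ι) :
    adjoint (opR (FreeMonoid.of i)) * opR (FreeMonoid.of j) = if i = j then 1 else 0 := by
  split_ifs with h
  · subst h
    exact (rowR ι).adjoint_comp_self i
  · exact (rowR ι).adjoint_comp_of_ne i j h

theorem adjoint_opR_of_xi_one (i : ι) : adjoint (opR (FreeMonoid.of i)) (xi 1) = 0 := by
  classical
  refine ext_xi_inner fun w => ?_
  rw [adjoint_inner_right, opR_xi, inner_xi_xi, if_neg, inner_zero_right]
  intro h
  simpa using congrArg FreeMonoid.length h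

/-- Induction on words that appends letters at the end. -/
theorem word_induction_right {p : FreeMonoid ι → Prop} (one : p 1)
    (mul_of : ∀ w i, p w → p (w * FreeMonoid.of i)) (w : FreeMonoid ι) : p w :=
  List.reverseRecOn (motive := p) w one fun w i h => mul_of w i h

end Basis

/-! ### The commutant of the right shifts contains the analytic Toeplitz algebra -/

section Commutant

variable {ι : Type*}

theorem isClosed_centralizer_WOT {H : Type*} [NormedAddCommGroup H] [InnerProductSpace ℂ H]
    [CompleteSpace H] (s : Set (H →L[ℂ] H)) :
    IsClosed {T : H →WOT[ℂ] H | T.toCLM ∈ Subalgebra.centralizer ℂ s} := by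
  have : {T : H →WOT[ℂ] H | T.toCLM ∈ Subalgebra.centralizer ℂ s} =
      ⋂ S ∈ s, {T : H →WOT[ℂ] H | .ofCLM S * T = T * .ofCLM S} := by
    ext T
    simp only [Set.mem_ofPred_eq, Subalgebra.mem_centralizer_iff, Set.mem_iInter]
    refine forall₂_congr fun S _ => ⟨fun h => ?_, fun h => congrArg (·.toCLM) h⟩
    exact ContinuousLinearMapWOT.toCLM_injective h
  rw [this]
  exact isClosed_biInter fun S _ =>
    isClosed_eq (continuous_const_mul _) (continuous_mul_const _)

theorem analyticToeplitz_le_centralizer :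
    analyticToeplitz ι ≤ Subalgebra.centralizer ℂ (Set.range fun i => opR (FreeMonoid.of i)) := by
  refine sInf_le ⟨fun i => ?_, isClosed_centralizer_WOT _⟩
  rw [Subalgebra.mem_centralizer_iff]
  rintro _ ⟨j, rfl⟩
  exact (opL_mul_opR _ _).symm

theorem commute_opR_of_mem {B : Fock ι →L[ℂ] Fock ι} (hB : B ∈ analyticToeplitz ι) (i : ι) :
    Commute (opR (FreeMonoid.of i)) B :=
  Subalgebra.mem_centralizer_iff ℂ |>.1 (analyticToeplitz_le_centralizer hB) _ ⟨i, rfl⟩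

theorem commute_opR {B : Fock ι →L[ℂ] Fock ι} (hB : ∀ i, Commute (opR (FreeMonoid.of i)) B)
    (w : FreeMonoid ι) : Commute (opR w) B := by
  induction w using word_induction_right with
  | one => simp [opR_one]
  | mul_of w i h => rw [opR_mul]; exact (hB i).mul_left h

theorem opL_mem (w : FreeMonoid ι) : opL w ∈ analyticToeplitz ι := by
  induction w using word_induction_right with
  | one => rw [opL_one]; exact one_mem _
  | mul_of w i h =>
    rw [opL_mul]
    exact mul_mem h ((rowL ι).op_mem_freeSemigroupAlgebra i)

/-- Membership in the `R`-Toeplitz operators, as one equation. -/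
theorem mem_toeplitz_iff [DecidableEq ι] {T : Fock ι →L[ℂ] Fock ι} :
    T ∈ (rowR ι).toeplitz ↔ ∀ i j,
      adjoint (opR (FreeMonoid.of i)) * T * opR (FreeMonoid.of j) = if i = j then T else 0 := by
  simp only [RowIsometry.toeplitz, Set.mem_ofPred_eq, mul_assoc]
  constructor
  · rintro ⟨h1, h2⟩ i j
    split_ifs with h
    · subst h; exact h1 i
    · exact h2 i j h
  · intro h
    exact ⟨fun i => by simpa using! h i i, fun i j hij => by simpa [hij] using! h i j⟩

theorem adjoint_mul_mem_toeplitz {B C : Fock ι →L[ℂ] Fock ι} (hB : B ∈ analyticToeplitz ι)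
    (hC : C ∈ analyticToeplitz ι) : adjoint B * C ∈ (rowR ι).toeplitz := by
  classical
  rw [mem_toeplitz_iff]
  intro i j
  have h1 : adjoint (opR (FreeMonoid.of i)) * adjoint B =
      adjoint B * adjoint (opR (FreeMonoid.of i)) := by
    simpa [star_mul] using! congrArg star (commute_opR_of_mem hB i).eq.symm
  calc _ = adjoint (opR (FreeMonoid.of i)) * adjoint B * (C * opR (FreeMonoid.of j)) := by
        simp only [mul_assoc]
    _ = adjoint B * (adjoint (opR (FreeMonoid.of i)) * opR (FreeMonoid.of j)) * C := by
        rw [h1, ← (commute_opR_of_mem hC j).eq]; simp only [mul_assoc]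
    _ = _ := by rw [adjoint_opR_of_mul_opR_of]; split_ifs <;> simp

end Commutant

/-! ### Abel means of an operator that commutes with the right shifts -/

section Convergence

theorem norm_sum_sq_of_pairwise_inner_eq_zero {κ E : Type*} [NormedAddCommGroup E]
    [InnerProductSpace ℂ E] (s : Finset κ) (f : κ → E)
    (h : ∀ i ∈ s, ∀ j ∈ s, i ≠ j → inner ℂ (f i) (f j) = 0) :
    ‖∑ i ∈ s, f i‖ ^ 2 = ∑ i ∈ s, ‖f i‖ ^ 2 := by
  classical
  induction s using Finset.induction_on with
  | empty => simp
  | insert i s hi ih =>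
    have h0 : inner ℂ (f i) (∑ j ∈ s, f j) = 0 := by
      rw [inner_sum]
      exact Finset.sum_eq_zero fun j hj => h i (Finset.mem_insert_self _ _) j
        (Finset.mem_insert_of_mem hj) (by rintro rfl; exact hi hj)
    rw [Finset.sum_insert hi, Finset.sum_insert hi, @norm_add_sq ℂ, h0, ih fun j hj k hk =>
      h j (Finset.mem_insert_of_mem hj) k (Finset.mem_insert_of_mem hk)]
    simp

theorem tendsto_apply_of_norm_le_of_dense {H G : Type*} [NormedAddCommGroup H] [NormedSpace ℂ H]
    [NormedAddCommGroup G] [NormedSpace ℂ G] {F : ℕ → H →L[ℂ] G} {f : H →L[ℂ] G} {C : ℝ}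
    (hC : ∀ n, ‖F n‖ ≤ C) {s : Set H} (hs : Dense (Submodule.span ℂ s : Set H))
    (h : ∀ x ∈ s, Tendsto (fun n => F n x) atTop (𝓝 (f x))) (x : H) :
    Tendsto (fun n => F n x) atTop (𝓝 (f x)) := by
  have hF : Equicontinuous fun n => ⇑(F n) :=
    ((NormedSpace.equicontinuous_TFAE F).out 5 1 rfl rfl).1 ⟨C, hC⟩
  have hcl := hF.isClosed_setOfPred_tendsto (l := atTop) f.continuous
  have hspan : (Submodule.span ℂ s : Set H) ⊆
      {x | Tendsto (fun n => F n x) atTop (𝓝 (f x))} := by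
    intro x hx
    induction hx using Submodule.span_induction with
    | mem x hx => exact h x hx
    | zero => simp
    | add x y _ _ hx hy => simpa using hx.add hy
    | smul c x _ hx => simpa using hx.const_smul c
  exact hcl.closure_subset_iff.2 hspan (hs x)

/-- A bounded sequence of operators whose matrix entries converge, converges weakly. -/
theorem tendsto_WOT_of_norm_le_of_entries {ι : Type*} {F : ℕ → Fock ι →L[ℂ] Fock ι}
    {f : Fock ι →L[ℂ] Fock ι} {C : ℝ} (hC : ∀ n, ‖F n‖ ≤ C)
    (h : ∀ u v, Tendsto (fun n => inner ℂ (xi u) (F n (xi v))) atTop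
      (𝓝 (inner ℂ (xi u) (f (xi v))))) :
    Tendsto (fun n => ContinuousLinearMapWOT.ofCLM (F n)) atTop (𝓝 (.ofCLM f)) := by
  rw [ContinuousLinearMapWOT.tendsto_iff_forall_inner_apply_tendsto]
  have h1 : ∀ v y, Tendsto (fun n => inner ℂ (F n (xi v)) y) atTop
      (𝓝 (inner ℂ (f (xi v)) y)) := by
    intro v y
    refine tendsto_apply_of_norm_le_of_dense (F := fun n => innerSL ℂ (F n (xi v)))
      (f := innerSL ℂ (f (xi v))) (C := C * 1) (fun n => ?_) dense_span_xi ?_ y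
    · rw [innerSL_apply_norm]
      refine (F n).le_of_opNorm_le (hC n) _ |>.trans_eq ?_
      rw [orthonormal_xi.1 v]
    · rintro _ ⟨u, rfl⟩
      simpa [Function.comp_def] using (Complex.continuous_conj.tendsto _).comp (h u v)
  intro x y
  refine tendsto_apply_of_norm_le_of_dense (F := fun n => innerSL ℂ y ∘L F n)
    (f := innerSL ℂ y ∘L f) (C := ‖y‖ * C) (fun n => ?_) dense_span_xi ?_ x
  · refine (opNorm_comp_le _ _).trans ?_
    rw [innerSL_apply_norm]
    gcongr
    exact hC n
  · rintro _ ⟨v, rfl⟩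
    simpa [Function.comp_def] using (Complex.continuous_conj.tendsto _).comp (h1 v y)

end Convergence

section AbelMean

variable {ι : Type*}

/-- The isometries `L_w`, for words `w` of one length, have mutually orthogonal ranges. -/
theorem norm_sum_smul_opL_le_of_length {s : Finset (FreeMonoid ι)} {m : ℕ}
    (hs : ∀ w ∈ s, w.length = m) (c : FreeMonoid ι → ℂ) :
    ‖∑ w ∈ s, c w • opL w‖ ≤ √(∑ w ∈ s, ‖c w‖ ^ 2) := by
  refine opNorm_le_bound _ (Real.sqrt_nonneg _) fun x => ?_
  have key : ‖∑ w ∈ s, c w • opL w x‖ ^ 2 = ∑ w ∈ s, ‖c w • opL w x‖ ^ 2 := by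
    refine norm_sum_sq_of_pairwise_inner_eq_zero _ _ fun u hu v hv huv => ?_
    have h0 : adjoint (opL u) * opL v = 0 := by
      refine adjoint_opL_mul_opL fun x y hxy => huv ?_
      exact (List.append_inj hxy ((hs u hu).trans (hs v hv).symm)).1
    have h1 : inner ℂ (opL u x) (opL v x) = 0 := by
      rw [← adjoint_inner_right]
      simpa using congrArg (fun T => inner ℂ x (T x)) h0
    simp [h1]
  rw [← pow_le_pow_iff_left₀ (norm_nonneg _) (by positivity) two_ne_zero, mul_pow,
    Real.sq_sqrt (by positivity), Finset.sum_mul]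
  simp only [sum_apply, smul_apply]
  rw [key]
  simp [norm_smul, mul_pow, norm_opL_apply]

/-- The words are grouped by length, and the bounds of the groups are summed as a geometric
series. -/
theorem norm_sum_pow_smul_opL_le {r : ℝ} (hr0 : 0 ≤ r) (hr1 : r < 1) (s : Finset (FreeMonoid ι))
    (c : FreeMonoid ι → ℂ) :
    ‖∑ w ∈ s, ((r : ℂ) ^ w.length * c w) • opL w‖ ≤ (1 - r)⁻¹ * √(∑ w ∈ s, ‖c w‖ ^ 2) := by
  classical
  rw [← Finset.sum_fiberwise_of_maps_to (t := s.image FreeMonoid.length)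
    (fun w hw => Finset.mem_image_of_mem _ hw)]
  have hm : ∀ m, ‖∑ w ∈ s with w.length = m, ((r : ℂ) ^ w.length * c w) • opL w‖ ≤
      r ^ m * √(∑ w ∈ s, ‖c w‖ ^ 2) := by
    intro m
    have h1 : ∑ w ∈ s with w.length = m, ((r : ℂ) ^ w.length * c w) • opL w =
        (r : ℂ) ^ m • ∑ w ∈ s with w.length = m, c w • opL w := by
      rw [Finset.smul_sum]
      refine Finset.sum_congr rfl fun w hw => ?_
      rw [(Finset.mem_filter.1 hw).2, mul_smul]
    rw [h1, norm_smul, norm_pow, Complex.norm_real, Real.norm_of_nonneg hr0]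
    gcongr
    refine (norm_sum_smul_opL_le_of_length (fun w hw => (Finset.mem_filter.1 hw).2) c).trans ?_
    gcongr
    exact Finset.filter_subset _ _
  refine (norm_sum_le _ _).trans ((Finset.sum_le_sum fun m _ => hm m).trans ?_)
  rw [← Finset.sum_mul, ← tsum_geometric_of_lt_one hr0 hr1]
  gcongr
  exact (summable_geometric_of_lt_one hr0 hr1).sum_le_tsum _ fun m _ => pow_nonneg hr0 m

theorem summable_pow_smul_opL {r : ℝ} (hr0 : 0 ≤ r) (hr1 : r < 1) (a : Fock ι) :
    Summable fun w => ((r : ℂ) ^ w.length * a w) • opL w := by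
  rw [summable_iff_vanishing_norm]
  intro ε hε
  have ha : Summable fun w => ‖a w‖ ^ 2 := by
    simpa using (lp.memℓp a).summable (by simp)
  have hr : 0 < 1 - r := sub_pos.2 hr1
  obtain ⟨s, hs⟩ := summable_iff_vanishing_norm.1 ha (((1 - r) * ε) ^ 2) (by positivity)
  refine ⟨s, fun t ht => (norm_sum_pow_smul_opL_le hr0 hr1 t a).trans_lt ?_⟩
  have h1 := hs t ht
  rw [Real.norm_of_nonneg (by positivity)] at h1
  rw [inv_mul_lt_iff₀ hr]
  exact (Real.sqrt_lt' (by positivity)).2 h1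

/-- The operator `∑_w r^{|w|} a_w L_w`, for a vector `a = ∑_w a_w ξ_w` of Fock space. It is the Abel
mean of an operator `A` that commutes with the right shifts when `a = A ξ_∅`. For `r` outside
`[0, 1)` the value is of no use. -/
def abelMean (r : ℝ) (a : Fock ι) : Fock ι →L[ℂ] Fock ι :=
  ∑' w, ((r : ℂ) ^ w.length * a w) • opL w

theorem abelMean_mem {r : ℝ} (hr0 : 0 ≤ r) (hr1 : r < 1) (a : Fock ι) :
    abelMean r a ∈ analyticToeplitz ι := by
  have hcl : IsClosed {T : Fock ι →L[ℂ] Fock ι | T ∈ analyticToeplitz ι} :=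
    (rowL ι).isClosed_freeSemigroupAlgebra.preimage ContinuousLinearMapWOT.continuous_ofCLM
  refine hcl.mem_of_tendsto (summable_pow_smul_opL hr0 hr1 a).hasSum (.of_forall fun s => ?_)
  exact sum_mem fun w _ => Subalgebra.smul_mem _ (opL_mem w) _

theorem hasSum_inner_xi_opR [DecidableEq (FreeMonoid ι)] (u v : FreeMonoid ι) (a : Fock ι) :
    HasSum (fun w => a w * if u = w * v then 1 else 0) (inner ℂ (xi u) (opR v a)) := by
  have h := ((xiBasis ι).hasSum_repr a).mapL (innerSL ℂ (xi u) ∘L opR v)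
  refine h.congr_fun fun w => ?_
  simp only [coe_xiBasis, (xiBasis ι).repr_apply_apply, comp_apply, map_smul, opR_xi,
    innerSL_apply_apply, smul_eq_mul, inner_xi_xi]
  rw [inner_xi_left]

theorem inner_xi_opR_eq_zero {u v : FreeMonoid ι} (h : u.length < v.length) (a : Fock ι) :
    inner ℂ (xi u) (opR v a) = 0 := by
  classical
  refine (hasSum_inner_xi_opR u v a).unique ?_
  convert hasSum_zero using 2 with w
  rw [if_neg, mul_zero]
  rintro rfl
  rw [FreeMonoid.length_mul] at h
  lia

/-- The truncation of `|u| - |v|` in `ℕ` is harmless: for `|u| < |v|` the entry of `R_v a` vanishes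
(`inner_xi_opR_eq_zero`). -/
theorem inner_xi_abelMean {r : ℝ} (hr0 : 0 ≤ r) (hr1 : r < 1) (u v : FreeMonoid ι) (a : Fock ι) :
    inner ℂ (xi u) (abelMean r a (xi v)) =
      (r : ℂ) ^ (u.length - v.length) * inner ℂ (xi u) (opR v a) := by
  classical
  have h := (summable_pow_smul_opL hr0 hr1 a).hasSum.mapL
    (innerSL ℂ (xi u) ∘L ContinuousLinearMap.apply ℂ (Fock ι) (xi v))
  refine h.unique (((hasSum_inner_xi_opR u v a).mul_left
    ((r : ℂ) ^ (u.length - v.length))).congr_fun fun w => ?_)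
  simp only [comp_apply, map_smul, apply_apply, opL_xi, innerSL_apply_apply, inner_xi_xi,
    smul_eq_mul]
  split_ifs with huw
  · subst huw
    simp [FreeMonoid.length_mul]
  · simp

variable {A : Fock ι →L[ℂ] Fock ι}

theorem apply_xi_of_commute (hA : ∀ i, Commute (opR (FreeMonoid.of i)) A) (v : FreeMonoid ι) :
    A (xi v) = opR v (A (xi 1)) := by
  have := congrArg (fun T => T (xi 1)) (commute_opR hA v).eq
  simpa [opR_xi] using this.symm

/-- The sections of an Abel mean are bounded by the norm of the operator. The entries of the Abel
mean at a complex parameter `z` are polynomials in `z`; on the unit circle that mean is unitarily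
equivalent to `A`, and the maximum modulus principle carries the bound into the disc. -/
theorem norm_sum_abel_le (hA : ∀ i, Commute (opR (FreeMonoid.of i)) A) {r : ℝ} (hr0 : 0 ≤ r)
    (hr1 : r < 1) (s : Finset (FreeMonoid ι)) (x y : FreeMonoid ι → ℂ) :
    ‖∑ u ∈ s, ∑ v ∈ s, star (y u) * x v * (r : ℂ) ^ (u.length - v.length) *
        inner ℂ (xi u) (A (xi v))‖ ≤
      ‖A‖ * ‖∑ v ∈ s, x v • (xi v : Fock ι)‖ * ‖∑ u ∈ s, y u • (xi u : Fock ι)‖ := by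
  -- The diagonal operator `ξ_v ↦ z̄^{|v|} ξ_v` is isometric for `|z| = 1`.
  have hnorm : ∀ (x : FreeMonoid ι → ℂ) (z : ℂ), ‖z‖ = 1 →
      ‖∑ v ∈ s, (x v * star z ^ v.length) • (xi v : Fock ι)‖ =
        ‖∑ v ∈ s, x v • (xi v : Fock ι)‖ := by
    intro x z hz
    have hsq : ∀ c : FreeMonoid ι → ℂ,
        ‖∑ v ∈ s, c v • (xi v : Fock ι)‖ ^ 2 = ∑ v ∈ s, ‖c v‖ ^ 2 := by
      intro c
      rw [norm_sum_sq_of_pairwise_inner_eq_zero]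
      · simp [norm_smul, orthonormal_xi.1]
      · intro u _ v _ huv
        simp [orthonormal_xi.2 huv]
    rw [← pow_left_inj₀ (norm_nonneg _) (norm_nonneg _) two_ne_zero, hsq, hsq]
    simp [hz]
  set f : ℂ → ℂ := fun z => ∑ u ∈ s, ∑ v ∈ s, star (y u) * x v * z ^ (u.length - v.length) *
    inner ℂ (xi u) (A (xi v)) with hf
  have hcircle : ∀ z : ℂ, ‖z‖ = 1 → f z =
      inner ℂ (∑ u ∈ s, (y u * star z ^ u.length) • (xi u : Fock ι))
        (A (∑ v ∈ s, (x v * star z ^ v.length) • (xi v : Fock ι))) := by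
    intro z hz
    simp only [hf, sum_inner]
    refine Finset.sum_congr rfl fun u _ => ?_
    simp only [map_sum, inner_sum]
    refine Finset.sum_congr rfl fun v _ => ?_
    rw [map_smul, inner_smul_left, inner_smul_right]
    -- Entries with `|u| < |v|` vanish, so the exponent `|u| - |v|` is never truncated.
    rcases lt_or_ge u.length v.length with h | h
    · rw [apply_xi_of_commute hA, inner_xi_opR_eq_zero h]
      simp
    · have hzz : z * star z = 1 := by
        rw [← starRingEnd_apply, Complex.mul_conj, Complex.normSq_eq_norm_sq, hz]; simp
      obtain ⟨k, hk⟩ := Nat.exists_eq_add_of_le h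
      have hpow : z ^ u.length * star z ^ v.length = z ^ (u.length - v.length) := by
        rw [hk, pow_add, Nat.add_sub_cancel_left, mul_right_comm, ← mul_pow, hzz, one_pow, one_mul]
      rw [← hpow]
      simp only [map_mul, map_pow, starRingEnd_apply, star_star]
      ring
  have hdiff : Differentiable ℂ f := by
    simp only [hf]
    fun_prop
  refine Complex.norm_le_of_forall_mem_frontier_norm_le (f := f) (U := Metric.ball 0 1)
    Metric.isBounded_ball hdiff.diffContOnCl (fun z hz => ?_) (subset_closure ?_)
  · rw [frontier_ball _ one_ne_zero, mem_sphere_zero_iff_norm] at hz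
    rw [hcircle z hz]
    refine (norm_inner_le_norm _ _).trans ?_
    rw [hnorm y z hz, mul_comm, ← hnorm x z hz]
    gcongr
    exact A.le_opNorm _
  · simpa [abs_of_nonneg hr0] using hr1

theorem norm_abelMean_le (hA : ∀ i, Commute (opR (FreeMonoid.of i)) A) {r : ℝ} (hr0 : 0 ≤ r)
    (hr1 : r < 1) : ‖abelMean r (A (xi 1))‖ ≤ ‖A‖ := by
  have hP : ∀ x : Fock ι, Tendsto (fun s : Finset (FreeMonoid ι) =>
      ∑ v ∈ s, x v • (xi v : Fock ι)) atTop
      (𝓝 x) := by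
    intro x
    have h := (xiBasis ι).hasSum_repr x
    simp only [coe_xiBasis, (xiBasis ι).repr_apply_apply, inner_xi_left] at h
    exact h
  have hbound : ∀ x y : Fock ι,
      ‖inner ℂ y (abelMean r (A (xi 1)) x)‖ ≤ ‖A‖ * ‖x‖ * ‖y‖ := by
    intro x y
    refine le_of_tendsto_of_tendsto
      ((hP y).inner ((abelMean r (A (xi 1))).continuous.tendsto x |>.comp (hP x))).norm
      (((hP x).norm.const_mul ‖A‖).mul (hP y).norm) (.of_forall fun s => ?_)
    refine le_trans (le_of_eq (congrArg norm ?_)) (norm_sum_abel_le hA hr0 hr1 s x y)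
    rw [Function.comp_apply, sum_inner]
    refine Finset.sum_congr rfl fun u _ => ?_
    simp only [map_sum, inner_sum]
    refine Finset.sum_congr rfl fun v _ => ?_
    rw [map_smul, inner_smul_left, inner_smul_right, inner_xi_abelMean hr0 hr1,
      apply_xi_of_commute hA v, starRingEnd_apply]
    ring
  refine opNorm_le_of_re_inner_le (norm_nonneg _) fun x y hx hy => ?_
  refine (RCLike.re_le_norm _).trans ?_
  rw [norm_inner_symm]
  simpa [hx, hy] using hbound x y

/-- An operator that commutes with every right shift is the weak limit of its Abel means. -/
theorem mem_analyticToeplitz_of_commute (hA : ∀ i, Commute (opR (FreeMonoid.of i)) A) :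
    A ∈ analyticToeplitz ι := by
  set r : ℕ → ℝ := fun n => n / (n + 1) with hr
  have hr0 : ∀ n, 0 ≤ r n := fun n => by positivity
  have hr1 : ∀ n, r n < 1 := fun n => by rw [hr, div_lt_one (by positivity)]; linarith
  have hlim : Tendsto r atTop (𝓝 1) := tendsto_natCast_div_add_atTop (1 : ℝ)
  have hcl : IsClosed {T : Fock ι →WOT[ℂ] Fock ι | T.toCLM ∈ analyticToeplitz ι} :=
    (rowL ι).isClosed_freeSemigroupAlgebra
  have hT : Tendsto (fun n => ContinuousLinearMapWOT.ofCLM (abelMean (r n) (A (xi 1)))) atTop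
      (𝓝 (.ofCLM A)) := by
    refine tendsto_WOT_of_norm_le_of_entries
      (fun n => norm_abelMean_le hA (hr0 n) (hr1 n)) fun u v => ?_
    simp only [inner_xi_abelMean (hr0 _) (hr1 _), ← apply_xi_of_commute hA]
    have h1 : Tendsto (fun n => (r n : ℂ)) atTop (𝓝 1) := by
      simpa [Function.comp_def] using (Complex.continuous_ofReal.tendsto _).comp hlim
    simpa using (h1.pow (u.length - v.length)).mul_const (inner ℂ (xi u) (A (xi v)))
  exact hcl.mem_of_tendsto hT (.of_forall fun n => abelMean_mem (hr0 n) (hr1 n) _)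

end AbelMean

/-! ### Outer factors of positive invertible Toeplitz operators -/

section BoundedBelow

variable {H : Type*} [NormedAddCommGroup H] [InnerProductSpace ℂ H]

theorem boundedBelow_one : BoundedBelow (1 : H →L[ℂ] H) := ⟨1, one_pos, fun x => by simp⟩

theorem BoundedBelow.of_mul_left {S B : H →L[ℂ] H} (h : BoundedBelow (S * B)) :
    BoundedBelow B := by
  obtain ⟨c, hc, h⟩ := h
  have hS : 0 < ‖S‖ + 1 := by positivity
  refine ⟨c / (‖S‖ + 1), by positivity, fun x => ?_⟩
  rw [div_mul_eq_mul_div, div_le_iff₀ hS, mul_comm ‖B x‖]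
  refine (h x).trans ((S.le_opNorm (B x)).trans ?_)
  gcongr
  linarith

end BoundedBelow

section Positive

variable {H : Type*} [NormedAddCommGroup H] [InnerProductSpace ℂ H] [CompleteSpace H]

theorem exists_isSelfAdjoint_mul_self_eq {T : H →L[ℂ] H} (hT : IsStrictlyPositive T) :
    ∃ A A' : H →L[ℂ] H, IsSelfAdjoint A ∧ A * A = T ∧ A * A' = 1 ∧ A' * A = 1 := by
  obtain ⟨A, hA⟩ := (CFC.isUnit_sqrt_iff T hT.nonneg).2 hT.isUnit
  exact ⟨A, ↑A⁻¹, hA ▸ (CFC.sqrt_nonneg T).isSelfAdjoint,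
    hA ▸ CFC.sqrt_mul_sqrt_self T hT.nonneg, A.mul_inv, A.inv_mul⟩

theorem isStrictlyPositive_add_norm_add_one_smul {T : H →L[ℂ] H} (hT : IsSelfAdjoint T) :
    IsStrictlyPositive (T + ((‖T‖ + 1 : ℝ) : ℂ) • 1) := by
  have h : 0 ≤ T + algebraMap ℝ (H →L[ℂ] H) ‖T‖ :=
    neg_le_iff_add_nonneg.1 hT.neg_algebraMap_norm_le_self
  have h1 : T + ((‖T‖ + 1 : ℝ) : ℂ) • 1 = (T + algebraMap ℝ (H →L[ℂ] H) ‖T‖) + 1 := by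
    rw [Algebra.algebraMap_eq_smul_one, Complex.coe_smul, add_smul, one_smul, add_assoc]
  rw [h1]
  exact IsStrictlyPositive.nonneg_add h isStrictlyPositive_one

end Positive

section Outer

variable {ι : Type*} {T : Fock ι →L[ℂ] Fock ι}

theorem inner_opR_of_toeplitz [DecidableEq ι] (hT : T ∈ (rowR ι).toeplitz) (i j : ι)
    (x y : Fock ι) :
    inner ℂ (opR (FreeMonoid.of i) x) (T (opR (FreeMonoid.of j) y)) =
      if i = j then inner ℂ x (T y) else 0 := by
  have h := congrArg (fun S => inner ℂ x (S y)) (mem_toeplitz_iff.1 hT i j)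
  simp only [mul_apply_eq_comp, adjoint_inner_right] at h
  rw [h]
  split_ifs <;> simp

/-- A Toeplitz operator commutes with `R_i^*` up to an operator that lives on the vacuum vector. -/
theorem adjoint_opR_apply_of_toeplitz (hT : T ∈ (rowR ι).toeplitz) (i : ι) {x : Fock ι}
    (hx : inner ℂ (xi 1) x = 0) :
    adjoint (opR (FreeMonoid.of i)) (T x) = T (adjoint (opR (FreeMonoid.of i)) x) := by
  classical
  -- The correction term is the rank-one operator `x ↦ ⟨ξ_∅, x⟩ R_i^* T ξ_∅`.
  have h : adjoint (opR (FreeMonoid.of i)) * T = T * adjoint (opR (FreeMonoid.of i)) +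
      (innerSL ℂ (xi 1)).smulRight (adjoint (opR (FreeMonoid.of i)) (T (xi 1))) := by
    refine ext_xi fun w => ?_
    induction w using word_induction_right with
    | one => simp [adjoint_opR_of_xi_one, orthonormal_xi.1]
    | mul_of w j _ =>
      have h1 := congrArg (fun S => S (xi w)) (mem_toeplitz_iff.1 hT i j)
      have h2 := congrArg (fun S => S (xi w)) (adjoint_opR_of_mul_opR_of i j)
      simp only [mul_apply_eq_comp, opR_xi] at h1 h2
      have h3 : inner ℂ (xi 1 : Fock ι) (xi (w * FreeMonoid.of j)) = 0 := by
        rw [inner_xi_xi, if_neg]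
        intro h
        simpa using congrArg FreeMonoid.length h
      simp only [mul_apply_eq_comp, add_apply, smulRight_apply, innerSL_apply_apply, h1,
        h2, h3]
      split_ifs <;> simp
  simpa [hx] using congrArg (fun S => S x) h

variable {e : Fock ι}

/-- The vector `e = T⁻¹ ξ_∅` is wandering for the right shifts in the form `⟨·, T ·⟩`. -/
theorem inner_opR_toeplitz_opR [DecidableEq (FreeMonoid ι)] (hT : T ∈ (rowR ι).toeplitz)
    (hTs : IsSelfAdjoint T) (he : T e = xi 1) (v w : FreeMonoid ι) :
    inner ℂ (opR v e) (T (opR w e)) = if v = w then inner ℂ e (T e) else 0 := by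
  classical
  have hsymm : ∀ x y, inner ℂ x (T y) = inner ℂ (T x) y := fun x y => by
    rw [← adjoint_inner_left, hTs.adjoint_eq]
  have h0 : ∀ (i : ι) (y : Fock ι), inner ℂ (xi 1) (opR (FreeMonoid.of i) y) = 0 := fun i y => by
    rw [← adjoint_inner_left, adjoint_opR_of_xi_one, inner_zero_left]
  have hne : ∀ (u : FreeMonoid ι) (i : ι), u * FreeMonoid.of i ≠ 1 := fun u i h => by
    simpa using congrArg FreeMonoid.length h
  induction v using word_induction_right generalizing w with
  | one =>
    induction w using word_induction_right with
    | one => simp [opR_one]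
    | mul_of w j _ =>
      rw [if_neg (hne w j).symm, opR_one, opR_mul, hsymm]
      simp [he, h0]
  | mul_of v i ih =>
    induction w using word_induction_right with
    | one =>
      rw [if_neg (hne v i), opR_one, opR_mul]
      simp only [mul_apply_eq_comp, one_apply_eq_self, he]
      rw [← inner_conj_symm, h0, map_zero]
    | mul_of w j _ =>
      simp only [opR_mul, mul_apply_eq_comp]
      rw [inner_opR_of_toeplitz hT, ih]
      have : v * FreeMonoid.of i = w * FreeMonoid.of j ↔ v = w ∧ i = j :=
        List.append_singleton_inj
      simp only [this]
      split_ifs <;> simp_all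

/-- The wandering vector `e = T⁻¹ ξ_∅` is cyclic for the right shifts: a vector orthogonal to its
orbit in the form `⟨·, T ·⟩` has no `ξ_∅`-coefficient, and each `R_i^*` preserves this
orthogonality. -/
theorem eq_zero_of_inner_opR_toeplitz_eq_zero (hT : T ∈ (rowR ι).toeplitz)
    (hTs : IsSelfAdjoint T) (he : T e = xi 1) {x : Fock ι}
    (hx : ∀ v, inner ℂ (opR v e) (T x) = 0) : x = 0 := by
  have key : ∀ w : FreeMonoid ι, ∀ x : Fock ι, (∀ v, inner ℂ (opR v e) (T x) = 0) →
      inner ℂ (xi w) x = 0 := by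
    have hone : ∀ x : Fock ι, (∀ v, inner ℂ (opR v e) (T x) = 0) → inner ℂ (xi 1) x = 0 := by
      intro x hx
      rw [← he, ← adjoint_inner_right, hTs.adjoint_eq]
      simpa [opR_one] using hx 1
    intro w
    induction w using word_induction_right with
    | one => exact hone
    | mul_of w i ih =>
      intro x hx
      rw [← opR_xi, ← adjoint_inner_right]
      refine ih _ fun v => ?_
      rw [← adjoint_opR_apply_of_toeplitz hT i (hone x hx), adjoint_inner_right]
      simpa [opR_mul] using hx (v * FreeMonoid.of i)
  exact ext_xi_inner fun w => by rw [key w x hx, inner_zero_right]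

/-- A positive invertible Toeplitz operator is `B^* B` for an invertible analytic `B`. The family
`T^{1/2} R_w e`, with `e = T⁻¹ ξ_∅`, is an orthogonal basis of vectors of one norm, and `B` follows
`T^{1/2}` by the unitary that carries the normalized basis to the canonical one. -/
theorem exists_adjoint_mul_self_of_isStrictlyPositive (hT : T ∈ (rowR ι).toeplitz)
    (hpos : IsStrictlyPositive T) :
    ∃ B ∈ analyticToeplitz ι, BoundedBelow B ∧ adjoint B * B = T := by
  classical
  have hTs : IsSelfAdjoint T := hpos.isSelfAdjoint
  obtain ⟨A, A', hAs, hAA, hA', hA'A⟩ := exists_isSelfAdjoint_mul_self_eq hpos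
  have hinner : ∀ x y, inner ℂ (A x) (A y) = inner ℂ x (T y) := fun x y => by
    rw [← adjoint_inner_right, hAs.adjoint_eq, ← hAA]
    rfl
  have hAA'x : ∀ x, A (A' x) = x := fun x => congrArg (fun S => S x) hA'
  have hA'Ax : ∀ x, A' (A x) = x := fun x => congrArg (fun S => S x) hA'A
  have hAAx : ∀ x, A (A x) = T x := fun x => congrArg (fun S => S x) hAA
  set e : Fock ι := A' (A' (xi 1)) with he_def
  have he : T e = xi 1 := by rw [← hAAx, he_def, hAA'x, hAA'x]
  set δ : ℝ := ‖A e‖ with hδ_def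
  have hδ : δ ≠ 0 := by
    rw [hδ_def, he_def, hAA'x, norm_ne_zero_iff]
    intro h
    have h1 := hAA'x (xi 1)
    rw [h, map_zero] at h1
    simpa [← h1] using (orthonormal_xi (ι := ι)).1 1
  have hδc : (δ : ℂ) ≠ 0 := by exact_mod_cast hδ
  set f : FreeMonoid ι → Fock ι := fun w => (δ : ℂ)⁻¹ • A (opR w e) with hf
  have horth : Orthonormal ℂ f := by
    rw [orthonormal_iff_ite]
    intro v w
    simp only [hf, inner_smul_left, inner_smul_right, hinner]
    rw [inner_opR_toeplitz_opR hT hTs he, ← hinner, inner_self_eq_norm_sq_to_K, ← hδ_def]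
    split_ifs
    · simp
      field_simp
    · simp
  have hbot : (Submodule.span ℂ (Set.range f))ᗮ = ⊥ := by
    rw [Submodule.eq_bot_iff]
    intro y hy
    rw [Submodule.mem_orthogonal] at hy
    have h1 : A' y = 0 := by
      refine eq_zero_of_inner_opR_toeplitz_eq_zero hT hTs he fun v => ?_
      have := hy (f v) (Submodule.subset_span ⟨v, rfl⟩)
      simp only [hf, inner_smul_left] at this
      rw [← hinner, hAA'x]
      simpa [hδ] using this
    rw [← hAA'x y, h1, map_zero]
  set b := HilbertBasis.mkOfOrthogonalEqBot horth hbot with hb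
  have hbf : ∀ w, b.repr.symm (xi w) = f w := fun w => by
    rw [xi, HilbertBasis.repr_symm_single, hb, HilbertBasis.coe_mkOfOrthogonalEqBot]
  set B : Fock ι →L[ℂ] Fock ι := b.repr.toContinuousLinearEquiv.toContinuousLinearMap ∘L A with hB
  set B' : Fock ι →L[ℂ] Fock ι :=
    A' ∘L b.repr.symm.toContinuousLinearEquiv.toContinuousLinearMap with hB'
  have hBB' : B * B' = 1 := by
    ext1 x
    simp [hB, hB', hAA'x]
  have hB'B : B' * B = 1 := by
    ext1 x
    simp [hB, hB', hA'Ax]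
  have hB'xi : ∀ w, B' (xi w) = (δ : ℂ)⁻¹ • opR w e := fun w => by
    simp [hB', hbf, hf, hA'Ax]
  have hcomm : ∀ i, Commute (opR (FreeMonoid.of i)) B := by
    intro i
    have h1 : opR (FreeMonoid.of i) * B' = B' * opR (FreeMonoid.of i) := by
      refine ext_xi fun w => ?_
      simp [hB'xi, opR_xi, opR_mul]
    calc opR (FreeMonoid.of i) * B = B * (B' * opR (FreeMonoid.of i)) * B := by
          rw [← mul_assoc, hBB', one_mul]
      _ = B * opR (FreeMonoid.of i) := by
          rw [← h1, mul_assoc, mul_assoc, hB'B, mul_one]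
  refine ⟨B, mem_analyticToeplitz_of_commute hcomm, ?_, ?_⟩
  · exact BoundedBelow.of_mul_left (S := B') (hB'B ▸ boundedBelow_one)
  · ext1 x
    refine ext_inner_left ℂ fun y => ?_
    rw [← hinner]
    simp [adjoint_inner_right, hB]

end Outer

/-! ### Factorization of general Toeplitz operators -/

section Factorization

variable {ι : Type*}

/-- The `R`-Toeplitz operators, as a linear subspace. -/
def toeplitzSubmodule (ι : Type*) : Submodule ℂ (Fock ι →L[ℂ] Fock ι) where
  carrier := (rowR ι).toeplitz
  add_mem' {S T} hS hT := by
    classical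
    rw [mem_toeplitz_iff] at *
    intro i j
    rw [mul_add, add_mul, hS, hT]
    split_ifs <;> simp
  zero_mem' := by
    classical
    simp [mem_toeplitz_iff]
  smul_mem' c T hT := by
    classical
    rw [mem_toeplitz_iff] at *
    intro i j
    rw [mul_smul_comm, smul_mul_assoc, hT]
    split_ifs <;> simp

theorem one_mem_toeplitz : (1 : Fock ι →L[ℂ] Fock ι) ∈ (rowR ι).toeplitz := by
  classical
  simpa [mem_toeplitz_iff] using adjoint_opR_of_mul_opR_of (ι := ι)

theorem star_mem_toeplitz {T : Fock ι →L[ℂ] Fock ι} (hT : T ∈ (rowR ι).toeplitz) :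
    star T ∈ (rowR ι).toeplitz := by
  classical
  rw [mem_toeplitz_iff] at *
  intro i j
  have h := congrArg star (hT j i)
  simp only [star_mul, ← star_eq_adjoint, star_star, ← mul_assoc, apply_ite star, star_zero] at h ⊢
  simpa [eq_comm] using h

theorem exists_add_smul_one_eq_adjoint_mul_self {T : Fock ι →L[ℂ] Fock ι}
    (hT : T ∈ (rowR ι).toeplitz) (hTs : IsSelfAdjoint T) :
    ∃ c : ℂ, ∃ B ∈ analyticToeplitz ι, BoundedBelow B ∧ adjoint B * B = T + c • 1 := by
  refine ⟨((‖T‖ + 1 : ℝ) : ℂ), exists_adjoint_mul_self_of_isStrictlyPositive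
    ((toeplitzSubmodule ι).add_mem hT
      ((toeplitzSubmodule ι).smul_mem _ one_mem_toeplitz))
    (isStrictlyPositive_add_norm_add_one_smul hTs)⟩

/-- Two letters give isometries `L_a`, `L_{ba}`, `L_{bb}` with orthogonal ranges, so a sum of three
products `B^* C` is one such product. -/
theorem exists_adjoint_mul_of_mem_toeplitz [Nontrivial ι] {T : Fock ι →L[ℂ] Fock ι}
    (hT : T ∈ (rowR ι).toeplitz) :
    ∃ B ∈ analyticToeplitz ι, ∃ C ∈ analyticToeplitz ι,
      BoundedBelow B ∧ BoundedBelow C ∧ T = adjoint B * C := by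
  have hre : (realPart T : Fock ι →L[ℂ] Fock ι) ∈ (rowR ι).toeplitz := by
    rw [realPart_apply_coe, ← Complex.coe_smul]
    exact (toeplitzSubmodule ι).smul_mem _ ((toeplitzSubmodule ι).add_mem hT (star_mem_toeplitz hT))
  have him : (imaginaryPart T : Fock ι →L[ℂ] Fock ι) ∈ (rowR ι).toeplitz := by
    rw [imaginaryPart_apply_coe, ← Complex.coe_smul]
    exact (toeplitzSubmodule ι).smul_mem _ ((toeplitzSubmodule ι).smul_mem _
      ((toeplitzSubmodule ι).sub_mem hT (star_mem_toeplitz hT)))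
  obtain ⟨c, X, hX, hXb, hXX⟩ := exists_add_smul_one_eq_adjoint_mul_self hre (realPart T).2
  obtain ⟨d, Y, hY, -, hYY⟩ := exists_add_smul_one_eq_adjoint_mul_self him (imaginaryPart T).2
  have hT' : T = adjoint X * X + Complex.I • (adjoint Y * Y) - (c + Complex.I * d) • 1 := by
    rw [hXX, hYY]
    nth_rewrite 1 [← realPart_add_I_smul_imaginaryPart T]
    module
  obtain ⟨a, b, hab⟩ := exists_pair_ne ι
  set U := opL (FreeMonoid.of a)
  set V := opL (FreeMonoid.of b * FreeMonoid.of a)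
  set W := opL (FreeMonoid.of b * FreeMonoid.of b)
  have hUU : star U * U = 1 := adjoint_opL_mul_self _
  have hVV : star V * V = 1 := adjoint_opL_mul_self _
  have hWW : star W * W = 1 := adjoint_opL_mul_self _
  have hUV : star U * V = 0 := adjoint_opL_mul_opL fun x y h => hab (List.cons.inj h).1
  have hUW : star U * W = 0 := adjoint_opL_mul_opL fun x y h => hab (List.cons.inj h).1
  have hVW : star V * W = 0 := adjoint_opL_mul_opL fun x y h =>
    hab (List.cons.inj (List.cons.inj h).2).1
  have hVU : star V * U = 0 := by simpa using congrArg star hUV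
  have hWU : star W * U = 0 := by simpa using congrArg star hUW
  have hWV : star W * V = 0 := by simpa using congrArg star hVW
  have hUm : U ∈ analyticToeplitz ι := opL_mem _
  have hVm : V ∈ analyticToeplitz ι := opL_mem _
  have hWm : W ∈ analyticToeplitz ι := opL_mem _
  have hmul : ∀ α β : ℂ, U * X + α • (V * Y) + β • W ∈ analyticToeplitz ι := fun α β =>
    add_mem (add_mem (mul_mem hUm hX) (Subalgebra.smul_mem _ (mul_mem hVm hY) _))
      (Subalgebra.smul_mem _ hWm _)
  have hbelow : ∀ α β : ℂ, BoundedBelow (U * X + α • (V * Y) + β • W) := fun α β => by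
    refine BoundedBelow.of_mul_left (S := star U) ?_
    simpa [mul_add, ← mul_assoc, hUU, hUV, hUW] using hXb
  refine ⟨_, hmul 1 1, _, hmul Complex.I (-(c + Complex.I * d)), hbelow _ _, hbelow _ _, ?_⟩
  have e : ∀ P Q S S' : Fock ι →L[ℂ] Fock ι, star (S * P) * (S' * Q) =
      star P * (star S * S') * Q := fun P Q S S' => by simp only [star_mul, mul_assoc]
  have e₁ : ∀ P S S' : Fock ι →L[ℂ] Fock ι, star (S * P) * S' = star P * (star S * S') :=
    fun P S S' => by simp only [star_mul, mul_assoc]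
  have e₂ : ∀ Q S S' : Fock ι →L[ℂ] Fock ι, star S * (S' * Q) = star S * S' * Q :=
    fun Q S S' => by simp only [mul_assoc]
  rw [hT']
  simp only [← star_eq_adjoint, one_smul, star_add, add_mul, mul_add, mul_smul_comm, e, e₁, e₂,
    hUU, hVV, hWW, hUV, hUW, hVW, hVU, hWU, hWV, mul_one, mul_zero, zero_mul]
  module

end Factorization

end

end FreeSemigroupAlg

/-- The letters form a type `ι` with at least two elements, finite or infinite. -/
theorem mainTheorem9 {ι : Type*} [Nontrivial ι] :
    (FreeSemigroupAlg.rowR ι).toeplitz =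
        {T | ∃ B ∈ FreeSemigroupAlg.analyticToeplitz ι, ∃ C ∈ FreeSemigroupAlg.analyticToeplitz ι,
          T = ContinuousLinearMap.adjoint B ∘L C} ∧
      ∀ T ∈ (FreeSemigroupAlg.rowR ι).toeplitz,
        ∃ B ∈ FreeSemigroupAlg.analyticToeplitz ι, ∃ C ∈ FreeSemigroupAlg.analyticToeplitz ι,
          FreeSemigroupAlg.BoundedBelow B ∧ FreeSemigroupAlg.BoundedBelow C ∧
            T = ContinuousLinearMap.adjoint B ∘L C := by
  refine ⟨Set.Subset.antisymm (fun T hT => ?_) ?_,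
    fun T hT => FreeSemigroupAlg.exists_adjoint_mul_of_mem_toeplitz hT⟩
  · obtain ⟨B, hB, C, hC, -, -, h⟩ := FreeSemigroupAlg.exists_adjoint_mul_of_mem_toeplitz hT
    exact ⟨B, hB, C, hC, h⟩
  · rintro _ ⟨B, hB, C, hC, rfl⟩
    exact FreeSemigroupAlg.adjoint_mul_mem_toeplitz hB hC
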